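/- **Theorem (sequential communication bounds for SpGEMM).** Let $A$ be an $I\times K$ matrix and $B$ a $K\times J$ matrix, neither with a zero row or a zero column. Let $S_A,S_B$ be their nonzero structures and let $S_C=\{(i,j):\exists k,\ (i,k)\in S_A,\ (k,j)\in S_B\}$ (numerical cancellation is ignored). *Hypergraph.* The vertex set $\mathcal V$ consists of a vertex $v_{ikj}$ for each nontrivial multiplication ($(i,k)\in S_A$ and $(k,j)\in S_B$) and vertices $v^A_{ik}$, $v^B_{kj}$, $v^C_{ij}$ for the elements of $S_A$, $S_B$, $S_C$. The nets are $n^A_{ik}=\{v^A_{ik}\}\cup\{v_{ikj}\}_j$, $n^B_{kj}=\{v^B_{kj}\}\cup\{v_{ikj}\}_i$ and $n^C_{ij}=\{v^C_{ij}\}\cup\{v_{ikj}\}_k$. An $n$-way partition $\{\mathcal V_1,\dots,\mathcal V_n\}$ of $\mathcal V$ (empty parts allowed) is called $S$-bounded if each part meets at most $S$ of the nets $n^A_{ik}$, at most $S$ of the nets $n^B_{kj}$ and at most $S$ of the nets $n^C_{ij}$. *Algorithms.* A summation tree is a finite directed acyclic graph with exactly one vertex of outdegree zero; its leaves are its vertices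 of indegree zero. Choose for each $(i,j)\in S_C$ a summation tree with leaves $\{v_{ikj}\}_k$, the trees being disjoint; adding the vertices $v^A_{ik}$, $v^B_{kj}$ and the edges $v^A_{ik}\to v_{ikj}$, $v^B_{kj}\to v_{ikj}$ gives a computation graph. A sequential SpGEMM algorithm with fast memory of size $M$ consists of such a graph and a finite execution of it in a two-level memory: initially memory holds exactly the inputs (vertices without predecessors), each in slow or fast memory or both; a move loads a vertex from slow to fast memory, stores a vertex from fast to slow memory, computes in fast memory a non-input vertex all of whose predecessors are in fast memory, or deletes a vertex from one of the memories; fast memory never holds more than $M$ vertices; at the end each output (vertex without successors) is in slow or fast memory. Its communication cost is its number of loads and stores. There is an absolute constant $\kappa>0$ such that for all such $A,B$ and all $M\ge 3$ the following hold. 1. Let $h$ be the minimum number of parts of a $2M$-bounded partition of $\mathcal V$ (the minimum exists). Then every sequential SpGEMM algorithm for $(A,B)$ with fast memory of size $M$ has communication cost at least $M(h-1)$. 2. This is tight up to a constant factor when $h>1$: there is then such an algorithm with communication cost at most $\kappa\,M(h-1)$. 3. More generally, for all integers $S\ge 1$ and $n \ge 0$ and every $S$-bounded $n$-way partition of $\mathcal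 V$ there is such an algorithm with communication cost at most $\kappa\,Mn(S/M+1)^3$. In 2 and 3 the algorithm can be chosen so that fast memory is empty before and after the computation. -/

import Mathlib

universe u

namespace SpGEMM

/-! ### Nonzero structures and the fine-grained hypergraph -/

/-- The nonzero structure of a matrix. -/
def nonzeros {X : Type u} [Zero X] {m n : ℕ} (A : Matrix (Fin m) (Fin n) X) :
    Set (Fin m × Fin n) :=
  {p | A p.1 p.2 ≠ 0}

/-- No row and no column of the matrix is zero. -/
def NoZeroRowOrColumn {X : Type u} [Zero X] {m n : ℕ} (A : Matrix (Fin m) (Fin n) X) : Prop :=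
  (∀ i, ∃ k, A i k ≠ 0) ∧ (∀ k, ∃ i, A i k ≠ 0)

section Hypergraph

variable {I K J : ℕ} (SA : Set (Fin I × Fin K)) (SB : Set (Fin K × Fin J))

/-- The nonzero structure of the product that is induced by those of the factors
(numerical cancellation is ignored). -/
def prodNonzeros : Set (Fin I × Fin J) :=
  {p | ∃ k, (p.1, k) ∈ SA ∧ (k, p.2) ∈ SB}

/-- The nontrivial multiplications `a i k * b k j`. -/
@[ext] structure Mult where
  i : Fin I
  k : Fin K
  j : Fin J
  left_mem : (i, k) ∈ SA
  right_mem : (k, j) ∈ SB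

/-- The entry of the first matrix that a multiplication uses. -/
def Mult.aEntry {SA : Set (Fin I × Fin K)} {SB : Set (Fin K × Fin J)} (m : Mult SA SB) : SA :=
  ⟨(m.i, m.k), m.left_mem⟩

/-- The entry of the second matrix that a multiplication uses. -/
def Mult.bEntry {SA : Set (Fin I × Fin K)} {SB : Set (Fin K × Fin J)} (m : Mult SA SB) : SB :=
  ⟨(m.k, m.j), m.right_mem⟩

/-- The entry of the product to which a multiplication contributes. -/
def Mult.cEntry {SA : Set (Fin I × Fin K)} {SB : Set (Fin K × Fin J)} (m : Mult SA SB) :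
    prodNonzeros SA SB :=
  ⟨(m.i, m.j), m.k, m.left_mem, m.right_mem⟩

/-- The vertices of the hypergraph: one for each nontrivial multiplication and one for each
nonzero entry of the two factors and of the product. -/
inductive Vertex where
  | mul (m : Mult SA SB)
  | a (p : SA)
  | b (p : SB)
  | c (p : prodNonzeros SA SB)

variable {SA SB}

/-- The net of a nonzero entry of the first factor. -/
def aNet (p : SA) : Set (Vertex SA SB) :=
  {v | v = Vertex.a p ∨ ∃ m : Mult SA SB, m.aEntry = p ∧ v = Vertex.mul m}

/-- The net of a nonzero entry of the second factor. -/
def bNet (p : SB) : Set (Vertex SA SB) :=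
  {v | v = Vertex.b p ∨ ∃ m : Mult SA SB, m.bEntry = p ∧ v = Vertex.mul m}

/-- The net of a nonzero entry of the product. -/
def cNet (p : prodNonzeros SA SB) : Set (Vertex SA SB) :=
  {v | v = Vertex.c p ∨ ∃ m : Mult SA SB, m.cEntry = p ∧ v = Vertex.mul m}

/-- A set of vertices meets at most `S` nets of each of the three kinds. -/
def MeetsAtMost (S : ℕ) (U : Set (Vertex SA SB)) : Prop :=
  {p : SA | (aNet p ∩ U).Nonempty}.encard ≤ S ∧
  {p : SB | (bNet p ∩ U).Nonempty}.encard ≤ S ∧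
  {p : prodNonzeros SA SB | (cNet p ∩ U).Nonempty}.encard ≤ S

/-- An `n`-way partition of the vertex set (parts may be empty), each part of which meets at
most `S` nets of each of the three kinds. -/
structure IsNetPartition (S : ℕ) {n : ℕ} (P : Fin n → Set (Vertex SA SB)) : Prop where
  cover : ⋃ t, P t = Set.univ
  disjoint : Pairwise fun s t => Disjoint (P s) (P t)
  meets : ∀ t, MeetsAtMost S (P t)

variable (SA SB)

/-- The possible numbers of parts of such a partition. -/
def partCounts (S : ℕ) : Set ℕ :=
  {n | ∃ P : Fin n → Set (Vertex SA SB), IsNetPartition S P}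

end Hypergraph

/-! ### Computation graphs of sparse matrix multiplication -/

/-- A summation tree with set of leaves `L`: a finite directed acyclic graph with exactly one
vertex of outdegree zero (the root), whose vertices of indegree zero are the elements of `L`. -/
structure SummationTree (L : Type) where
  Inner : Type
  finite_inner : Finite Inner
  edge : L ⊕ Inner → L ⊕ Inner → Prop
  acyclic : ∀ v, ¬ Relation.TransGen edge v v
  leaf_iff : ∀ v, (∀ w, ¬ edge w v) ↔ ∃ l, v = Sum.inl l
  root : ∃! v, ∀ w, ¬ edge v w

section ComputationGraph

variable {I K J : ℕ} (SA : Set (Fin I × Fin K)) (SB : Set (Fin K × Fin J))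

/-- The products that are summed to get the entry `p` of the product matrix. -/
abbrev Term (p : Fin I × Fin J) : Type :=
  {k : Fin K // (p.1, k) ∈ SA ∧ (k, p.2) ∈ SB}

/-- A choice of disjoint summation trees, one for each nonzero entry of the product. It
determines one computation graph. -/
abbrev Trees : Type 1 :=
  (p : prodNonzeros SA SB) → SummationTree (Term SA SB p.1)

variable {SA SB}

/-- The vertices of the computation graph: the nonzero entries of the factors and the vertices of
the summation trees, whose leaves are the multiplications. -/
inductive GraphVertex (T : Trees SA SB) where
  | a (p : SA)
  | b (p : SB)
  | sum (p : prodNonzeros SA SB) (v : Term SA SB p.1 ⊕ (T p).Inner)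

/-- The multiplications as vertices of the computation graph. -/
def GraphVertex.mul {T : Trees SA SB} (m : Mult SA SB) : GraphVertex T :=
  GraphVertex.sum m.cEntry (Sum.inl ⟨m.k, m.left_mem, m.right_mem⟩)

/-- The edges of the computation graph. -/
inductive GraphEdge (T : Trees SA SB) : GraphVertex T → GraphVertex T → Prop
  | left (m : Mult SA SB) : GraphEdge T (GraphVertex.a m.aEntry) (GraphVertex.mul m)
  | right (m : Mult SA SB) : GraphEdge T (GraphVertex.b m.bEntry) (GraphVertex.mul m)
  | tree (p : prodNonzeros SA SB) (v w : Term SA SB p.1 ⊕ (T p).Inner) :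
      (T p).edge v w → GraphEdge T (GraphVertex.sum p v) (GraphVertex.sum p w)

end ComputationGraph

/-! ### Two-level memory: the red-blue pebble game on a directed graph -/

section Memory

variable {V : Type u}

/-- The vertices without predecessors. -/
def inputs (E : V → V → Prop) : Set V := {v | ∀ w, ¬ E w v}

/-- The vertices without successors. -/
def outputs (E : V → V → Prop) : Set V := {v | ∀ w, ¬ E v w}

/-- The values held in fast memory (red pebbles) and in slow memory (blue pebbles). -/
structure Memory (V : Type u) where
  fast : Set V
  slow : Set V

inductive Move (V : Type u) where
  | load (v : V)
  | store (v : V)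
  | compute (v : V)
  | dropFast (v : V)
  | dropSlow (v : V)

/-- Loads and stores cost one word each; all other moves are free. -/
def Move.words : Move V → ℕ
  | .load _ => 1
  | .store _ => 1
  | .compute _ => 0
  | .dropFast _ => 0
  | .dropSlow _ => 0

/-- The effect of a legal move. A vertex can be computed if it is not an input and all its
predecessors are in fast memory. -/
inductive Step (E : V → V → Prop) : Memory V → Move V → Memory V → Prop
  | load (s : Memory V) (v : V) : v ∈ s.slow →
      Step E s (Move.load v) ⟨insert v s.fast, s.slow⟩
  | store (s : Memory V) (v : V) : v ∈ s.fast →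
      Step E s (Move.store v) ⟨s.fast, insert v s.slow⟩
  | compute (s : Memory V) (v : V) : v ∉ inputs E → (∀ w, E w v → w ∈ s.fast) →
      Step E s (Move.compute v) ⟨insert v s.fast, s.slow⟩
  | dropFast (s : Memory V) (v : V) : Step E s (Move.dropFast v) ⟨s.fast \ {v}, s.slow⟩
  | dropSlow (s : Memory V) (v : V) : Step E s (Move.dropSlow v) ⟨s.fast, s.slow \ {v}⟩

/-- `Run E M s l s'`: the sequence `l` of legal moves leads from `s` to `s'`, and fast memory
never holds more than `M` words. -/
inductive Run (E : V → V → Prop) (M : ℕ) : Memory V → List (Move V) → Memory V → Prop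
  | nil (s : Memory V) : s.fast.encard ≤ M → Run E M s [] s
  | cons (s s' s'' : Memory V) (m : Move V) (l : List (Move V)) : s.fast.encard ≤ M →
      Step E s m s' → Run E M s' l s'' → Run E M s (m :: l) s''

end Memory

/-! ### Sequential algorithms -/

section Algorithm

variable {I K J : ℕ} (SA : Set (Fin I × Fin K)) (SB : Set (Fin K × Fin J))

/-- A sequential algorithm for the given nonzero structures with fast memory of size `M`: a
computation graph and an execution of it, which starts from the inputs and produces all
outputs, each in fast or slow memory. -/
structure Algorithm (M : ℕ) where
  trees : Trees SA SB
  start : Memory (GraphVertex trees)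
  finish : Memory (GraphVertex trees)
  moves : List (Move (GraphVertex trees))
  start_eq : start.fast ∪ start.slow = inputs (GraphEdge trees)
  run : Run (GraphEdge trees) M start moves finish
  complete : outputs (GraphEdge trees) ⊆ finish.fast ∪ finish.slow

variable {SA SB}

/-- The communication cost: the number of loads and stores. -/
def Algorithm.cost {M : ℕ} (alg : Algorithm SA SB M) : ℕ :=
  (alg.moves.map Move.words).sum

/-- Fast memory is empty before and after the computation, so that all inputs are initially, and
all outputs finally, in slow memory. -/
def Algorithm.FromSlowToSlow {M : ℕ} (alg : Algorithm SA SB M) : Prop :=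
  alg.start.fast = ∅ ∧ alg.finish.fast = ∅

end Algorithm

end SpGEMM

/-! Lower bound. Cut an execution into `cost / M + 1` segments of at most `M` words each. Charge a
multiplication to the first segment that ends with some descendant of its product in memory. Memory
holds no descendant when that segment starts, so the first one to enter must be the product itself,
and both factors are then in fast memory. Each was there when the segment started or was loaded
during it, which leaves at most `2 * M` entries of either factor. Likewise the descendant is in fast
memory at the end of the segment or was stored during it, which leaves at most `2 * M` entries of
the product matrix. Hence the segments give a `2 * M`-bounded partition
(`Algorithm.mem_partCounts`), and `h - 1 ≤ cost / M`. Recomputation does no harm, since only the end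
of a segment counts.

Upper bound. Order the multiplications and let every summation tree be a chain of partial sums in
that order. A computation can then be interrupted anywhere, provided that slow memory holds the
inputs and the latest sum of each entry (`Resumable`). A block that involves at most `b` entries of
each matrix runs in `3 * b + 2` words of fast memory: `3 * b` loads, free arithmetic, `b` stores
(`Resumable.exists_block`). If the entries of each matrix met by an `S`-bounded part are split into
`S / b + 1` groups, the part falls into `(S / b + 1) ^ 3` such blocks. Taking `b` proportional to
`M` gives the third claim, and `S = 2 * M` gives the second. -/

namespace SpGEMM

/-! ### Segments of a run and what passes through fast memory during one. -/

section Pebbling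

variable {V : Type u} {E : V → V → Prop} {M : ℕ}

theorem Run.fast_start_le {s s' : Memory V} {l : List (Move V)} (h : Run E M s l s') :
    s.fast.encard ≤ M := by
  cases h <;> assumption

theorem Run.fast_finish_le {s s' : Memory V} {l : List (Move V)} (h : Run E M s l s') :
    s'.fast.encard ≤ M := by
  induction h with
  | nil _ h => exact h
  | cons _ _ _ _ _ _ _ _ ih => exact ih

theorem Run.append {s s' s'' : Memory V} {l l' : List (Move V)} (h : Run E M s l s')
    (h' : Run E M s' l' s'') : Run E M s (l ++ l') s'' := by
  induction h with
  | nil _ _ => exact h'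
  | cons _ _ _ _ _ hM hs _ ih => exact Run.cons _ _ _ _ _ hM hs (ih h')

theorem Run.of_append {s s'' : Memory V} {l l' : List (Move V)} (h : Run E M s (l ++ l') s'') :
    ∃ s', Run E M s l s' ∧ Run E M s' l' s'' := by
  induction l generalizing s with
  | nil => exact ⟨s, Run.nil _ h.fast_start_le, h⟩
  | cons m l ih =>
    cases h with
    | cons _ s1 _ _ _ hM hs hr =>
      obtain ⟨s', h1, h2⟩ := ih hr
      exact ⟨s', Run.cons _ _ _ _ _ hM hs h1, h2⟩

theorem Move.words_le_one (m : Move V) : m.words ≤ 1 := by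
  cases m <;> simp [Move.words]

/-- A single move costs at most one word, so the running cost cannot jump over `M`: a prefix costs
exactly `M` unless the list ends first. -/
theorem exists_prefix_words (M : ℕ) (l : List (Move V)) :
    ∃ l₁ l₂, l = l₁ ++ l₂ ∧ (l₁.map Move.words).sum ≤ M ∧
      ((l₁.map Move.words).sum = M ∨ l₂ = []) := by
  induction l generalizing M with
  | nil => exact ⟨[], [], by simp⟩
  | cons m l ih =>
    rcases Nat.eq_zero_or_pos M with rfl | hM
    · exact ⟨[], m :: l, by simp⟩
    · obtain ⟨l₁, l₂, rfl, h1, h2⟩ := ih (M - m.words)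
      have := m.words_le_one
      refine ⟨m :: l₁, l₂, by simp, ?_, ?_⟩
      · simp only [List.map_cons, List.sum_cons]; omega
      · simp only [List.map_cons, List.sum_cons]
        exact h2.imp (fun h => by omega) id

/-- A run with at most `(k + 1) * M` words of communication splits into `k + 1` segments with at
most `M` words each. -/
theorem Run.exists_segments {s s' : Memory V} {l : List (Move V)} (h : Run E M s l s') (k : ℕ)
    (hk : (l.map Move.words).sum ≤ (k + 1) * M) :
    ∃ (σ : ℕ → Memory V) (ℓ : ℕ → List (Move V)), σ 0 = s ∧ σ (k + 1) = s' ∧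
      ∀ i ≤ k, Run E M (σ i) (ℓ i) (σ (i + 1)) ∧ ((ℓ i).map Move.words).sum ≤ M := by
  induction k generalizing s l with
  | zero =>
    refine ⟨fun i => if i = 0 then s else s', fun _ => l, rfl, rfl, ?_⟩
    intro i hi
    obtain rfl : i = 0 := by omega
    exact ⟨h, by simpa using hk⟩
  | succ k ih =>
    obtain ⟨l₁, l₂, rfl, h1, h2⟩ := exists_prefix_words M l
    obtain ⟨s₁, r₁, r₂⟩ := h.of_append
    have h3 : (l₂.map Move.words).sum ≤ (k + 1) * M := by
      rcases h2 with h2 | rfl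
      · rw [List.map_append, List.sum_append] at hk
        have : (k + 1 + 1) * M = (k + 1) * M + M := by ring
        omega
      · simp
    obtain ⟨σ, ℓ, h0, h4, h5⟩ := ih r₂ h3
    refine ⟨fun i => i.casesOn s σ, fun i => i.casesOn l₁ ℓ, rfl, h4, ?_⟩
    rintro (_ | i) hi
    · exact ⟨by simpa [h0] using r₁, h1⟩
    · exact h5 i (by omega)

theorem encard_setOf_load_mem_le (l : List (Move V)) :
    {v | Move.load v ∈ l}.encard ≤ (l.map Move.words).sum := by
  induction l with
  | nil => simp
  | cons m l ih =>
    cases m with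
    | load v =>
      have : {w | Move.load w ∈ Move.load v :: l} = insert v {w | Move.load w ∈ l} := by
        ext w; simp
      rw [this]
      refine (Set.encard_insert_le _ _).trans ?_
      simp only [List.map_cons, List.sum_cons, Move.words, Nat.cast_add, Nat.cast_one]
      rw [add_comm]
      gcongr
    | _ => simpa [Move.words] using ih.trans (by simp)

theorem encard_setOf_store_mem_le (l : List (Move V)) :
    {v | Move.store v ∈ l}.encard ≤ (l.map Move.words).sum := by
  induction l with
  | nil => simp
  | cons m l ih =>
    cases m with
    | store v =>
      have : {w | Move.store w ∈ Move.store v :: l} = insert v {w | Move.store w ∈ l} := by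
        ext w; simp
      rw [this]
      refine (Set.encard_insert_le _ _).trans ?_
      simp only [List.map_cons, List.sum_cons, Move.words, Nat.cast_add, Nat.cast_one]
      rw [add_comm]
      gcongr
    | _ => simpa [Move.words] using ih.trans (by simp)

/-- What is in slow memory after a run was there before or has been stored. -/
theorem Run.slow_or_store {s s' : Memory V} {l : List (Move V)} (h : Run E M s l s') {v : V}
    (hv : v ∈ s'.slow) : v ∈ s.slow ∨ Move.store v ∈ l := by
  induction h with
  | nil _ _ => exact Or.inl hv
  | cons s s1 _ m l _ hs _ ih =>
    rcases ih hv with h | h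
    · cases hs with
      | store w _ =>
        rcases h with rfl | h
        · simp
        · exact Or.inl h
      | dropSlow w => exact Or.inl h.1
      | _ => exact Or.inl h
    · exact Or.inr (List.mem_cons_of_mem _ h)

/-- Let every vertex of `D` other than `v` have a predecessor in `D`. A run during which `D`
enters memory has every input among the predecessors of `v` in fast memory at some time. -/
theorem Run.input_fast_or_load {s s' : Memory V} {l : List (Move V)} (h : Run E M s l s')
    {D : Set V} {v x : V} (hD : ∀ y ∈ D, y ≠ v → ∃ w ∈ D, E w y) (hx : x ∈ inputs E)
    (hxv : E x v) (h0 : ∀ y ∈ D, y ∉ s.fast ∪ s.slow) (h1 : ∃ y ∈ D, y ∈ s'.fast ∪ s'.slow) :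
    x ∈ s.fast ∨ Move.load x ∈ l := by
  induction h with
  | nil _ _ =>
    obtain ⟨y, hy, hy'⟩ := h1
    exact absurd hy' (h0 y hy)
  | cons s s1 _ m l _ hs _ ih =>
    by_cases hc : ∀ y ∈ D, y ∉ s1.fast ∪ s1.slow
    · rcases ih hc h1 with h | h
      · cases hs with
        | load w _ =>
          rcases h with rfl | h
          · simp
          · exact Or.inl h
        | compute w hw _ =>
          rcases h with rfl | h
          · exact absurd hx hw
          · exact Or.inl h
        | dropFast w => exact Or.inl h.1
        | _ => exact Or.inl h
      · exact Or.inr (List.mem_cons_of_mem _ h)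
    -- This is the move by which `D` enters memory. Loads, stores and deletions create no new value,
    -- so it is a computation; a vertex of `D` other than `v` would need a predecessor in `D` that
    -- is already in fast memory.
    · push Not at hc
      obtain ⟨y, hy, hy'⟩ := hc
      have hy0 := h0 y hy
      simp only [Set.mem_union, not_or] at hy0
      cases hs with
      | load w hw =>
        rcases hy' with (rfl | h) | h
        exacts [absurd hw hy0.2, absurd h hy0.1, absurd h hy0.2]
      | store w hw =>
        rcases hy' with h | (rfl | h)
        exacts [absurd h hy0.1, absurd hw hy0.1, absurd h hy0.2]
      | dropFast w =>
        rcases hy' with h | h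
        exacts [absurd h.1 hy0.1, absurd h hy0.2]
      | dropSlow w =>
        rcases hy' with h | h
        exacts [absurd h hy0.1, absurd h.1 hy0.2]
      | compute w hw hp =>
        rcases hy' with (rfl | h) | h
        · by_cases hyv : y = v
          · subst hyv
            exact Or.inl (hp x hxv)
          · obtain ⟨z, hz, hzy⟩ := hD y hy hyv
            exact absurd (Or.inl (hp z hzy)) (h0 z hz)
        · exact absurd h hy0.1
        · exact absurd h hy0.2

end Pebbling

/-! ### From an algorithm to a partition of the hypergraph. -/

section LowerBound

variable {I K J : ℕ} {SA : Set (Fin I × Fin K)} {SB : Set (Fin K × Fin J)}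

/-- Every vertex of a summation tree leads to its root. -/
theorem SummationTree.exists_root_reachable {L : Type} [Finite L] (T : SummationTree L)
    (v : L ⊕ T.Inner) : ∃ w, Relation.ReflTransGen T.edge v w ∧ ∀ x, ¬ T.edge w x := by
  have := T.finite_inner
  have hirr : Std.Irrefl (Relation.TransGen (Function.swap T.edge)) :=
    ⟨fun a h => T.acyclic a (Relation.transGen_swap.1 h)⟩
  have hwf : WellFounded (Relation.TransGen (Function.swap T.edge)) :=
    Finite.wellFounded_of_trans_of_irrefl _
  induction v using hwf.induction with
  | _ v ih =>
    by_cases h : ∃ x, T.edge v x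
    · obtain ⟨x, hx⟩ := h
      obtain ⟨w, hw, hw'⟩ := ih x (.single hx)
      exact ⟨w, .head hx hw, hw'⟩
    · push Not at h
      exact ⟨v, .refl, h⟩

theorem a_mem_inputs (T : Trees SA SB) (p : SA) : GraphVertex.a p ∈ inputs (GraphEdge T) := by
  intro w h
  cases h

theorem b_mem_inputs (T : Trees SA SB) (p : SB) : GraphVertex.b p ∈ inputs (GraphEdge T) := by
  intro w h
  cases h

theorem mul_notMem_inputs (T : Trees SA SB) (m : Mult SA SB) :
    GraphVertex.mul m ∉ inputs (GraphEdge T) :=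
  fun h => h _ (GraphEdge.left m)

/-- The values to which a multiplication contributes. -/
def dependents (T : Trees SA SB) (m : Mult SA SB) : Set (GraphVertex T) :=
  {y | Relation.ReflTransGen (GraphEdge T) (GraphVertex.mul m) y}

theorem exists_pred_mem_dependents {T : Trees SA SB} {m : Mult SA SB} {y : GraphVertex T}
    (hy : y ∈ dependents T m) (hne : y ≠ GraphVertex.mul m) :
    ∃ w ∈ dependents T m, GraphEdge T w y := by
  rcases Relation.ReflTransGen.cases_tail hy with h | ⟨w, hw, hwy⟩
  · exact absurd h hne
  · exact ⟨w, hw, hwy⟩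

theorem notMem_inputs_of_mem_dependents {T : Trees SA SB} {m : Mult SA SB} {y : GraphVertex T}
    (hy : y ∈ dependents T m) : y ∉ inputs (GraphEdge T) := by
  by_cases h : y = GraphVertex.mul m
  · exact h ▸ mul_notMem_inputs T m
  · obtain ⟨w, -, hw⟩ := exists_pred_mem_dependents hy h
    exact fun h' => h' w hw

/-- No edge leaves a summation tree. A word of memory can therefore account for only one entry of
the product. -/
theorem exists_eq_sum_of_mem_dependents {T : Trees SA SB} {m : Mult SA SB} {y : GraphVertex T}
    (hy : y ∈ dependents T m) : ∃ v, y = GraphVertex.sum m.cEntry v := by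
  induction hy with
  | refl => exact ⟨_, rfl⟩
  | tail _ h ih =>
    obtain ⟨v, rfl⟩ := ih
    cases h with
    | tree p v w h => exact ⟨w, rfl⟩

theorem exists_output_mem_dependents (T : Trees SA SB) (m : Mult SA SB) :
    ∃ y ∈ dependents T m, y ∈ outputs (GraphEdge T) := by
  obtain ⟨w, hw, hw'⟩ := (T m.cEntry).exists_root_reachable
    (Sum.inl ⟨m.k, m.left_mem, m.right_mem⟩)
  refine ⟨GraphVertex.sum m.cEntry w, ?_, ?_⟩
  · exact Relation.ReflTransGen.lift (GraphVertex.sum m.cEntry)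
      (fun v w h => GraphEdge.tree m.cEntry v w h) _ _ hw
  · intro x hx
    cases hx with
    | tree p v w h => exact hw' _ h

/-- The counting step for a segment: `t₁` is the content of fast memory at one end, `t₂` the set of
words moved, and the partial map `f` reads off the entry that a word belongs to. -/
theorem encard_le_two_mul {α β : Type*} {M : ℕ} {s : Set α} {t₁ t₂ : Set β} (f : β → Option α)
    (h₁ : t₁.encard ≤ M) (h₂ : t₂.encard ≤ M) (h : ∀ x ∈ s, ∃ y ∈ t₁ ∪ t₂, f y = some x) :
    s.encard ≤ (2 * M : ℕ) := by
  have hs : some '' s ⊆ f '' (t₁ ∪ t₂) := by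
    rintro _ ⟨x, hx, rfl⟩
    exact h x hx
  calc s.encard = (some '' s).encard := ((Option.some_injective α).injOn.encard_image).symm
    _ ≤ (f '' (t₁ ∪ t₂)).encard := Set.encard_le_encard hs
    _ ≤ (t₁ ∪ t₂).encard := Set.encard_image_le _ _
    _ ≤ t₁.encard + t₂.encard := Set.encard_union_le _ _
    _ ≤ (M : ℕ∞) + M := add_le_add h₁ h₂
    _ = (2 * M : ℕ) := by push_cast; ring

/-- The entry of the first factor that a vertex stands for. -/
def GraphVertex.toA {T : Trees SA SB} : GraphVertex T → Option SA
  | .a p => some p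
  | _ => none

/-- The entry of the second factor that a vertex stands for. -/
def GraphVertex.toB {T : Trees SA SB} : GraphVertex T → Option SB
  | .b p => some p
  | _ => none

/-- The entry of the product to whose summation tree a vertex belongs. -/
def GraphVertex.toC {T : Trees SA SB} : GraphVertex T → Option (prodNonzeros SA SB)
  | .sum p _ => some p
  | _ => none

theorem exists_aEntry_eq (hB : ∀ k, ∃ j, (k, j) ∈ SB) (p : SA) :
    ∃ m : Mult SA SB, m.aEntry = p := by
  obtain ⟨⟨i, k⟩, hp⟩ := p
  obtain ⟨j, hj⟩ := hB k
  exact ⟨⟨i, k, j, hp, hj⟩, rfl⟩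

theorem exists_bEntry_eq (hA : ∀ k, ∃ i, (i, k) ∈ SA) (p : SB) :
    ∃ m : Mult SA SB, m.bEntry = p := by
  obtain ⟨⟨k, j⟩, hp⟩ := p
  obtain ⟨i, hi⟩ := hA k
  exact ⟨⟨i, k, j, hi, hp⟩, rfl⟩

theorem exists_cEntry_eq (p : prodNonzeros SA SB) : ∃ m : Mult SA SB, m.cEntry = p := by
  obtain ⟨⟨i, j⟩, k, h₁, h₂⟩ := p
  exact ⟨⟨i, k, j, h₁, h₂⟩, rfl⟩

/-- Assigning the multiplications to parts determines a partition of all vertices, in which every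
entry joins one of the multiplications of its net. -/
theorem exists_isNetPartition_of_mult (hA : ∀ k, ∃ i, (i, k) ∈ SA) (hB : ∀ k, ∃ j, (k, j) ∈ SB)
    {S n : ℕ} (t : Mult SA SB → Fin n)
    (ha : ∀ i, {p : SA | ∃ m, t m = i ∧ m.aEntry = p}.encard ≤ S)
    (hb : ∀ i, {p : SB | ∃ m, t m = i ∧ m.bEntry = p}.encard ≤ S)
    (hc : ∀ i, {p : prodNonzeros SA SB | ∃ m, t m = i ∧ m.cEntry = p}.encard ≤ S) :
    n ∈ partCounts SA SB S := by
  -- An entry vertex lies in no net but its own. Placed with a multiplication of that net, it adds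
  -- no net to the part.
  choose fa hfa using exists_aEntry_eq (SA := SA) hB
  choose fb hfb using exists_bEntry_eq (SB := SB) hA
  choose fc hfc using exists_cEntry_eq (SA := SA) (SB := SB)
  let τ : Vertex SA SB → Fin n := fun
    | .mul m => t m
    | .a p => t (fa p)
    | .b p => t (fb p)
    | .c p => t (fc p)
  refine ⟨fun i => {x | τ x = i}, ?_, ?_, fun i => ⟨?_, ?_, ?_⟩⟩
  · ext x; simp
  · intro i j hij
    rw [Set.disjoint_left]
    intro x hx hx'
    exact hij (hx.symm.trans hx')
  · refine (Set.encard_le_encard ?_).trans (ha i)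
    rintro p ⟨x, rfl | ⟨m, hm, rfl⟩, hx⟩
    · exact ⟨fa p, hx, hfa p⟩
    · exact ⟨m, hx, hm⟩
  · refine (Set.encard_le_encard ?_).trans (hb i)
    rintro p ⟨x, rfl | ⟨m, hm, rfl⟩, hx⟩
    · exact ⟨fb p, hx, hfb p⟩
    · exact ⟨m, hx, hm⟩
  · refine (Set.encard_le_encard ?_).trans (hc i)
    rintro p ⟨x, rfl | ⟨m, hm, rfl⟩, hx⟩
    · exact ⟨fc p, hx, hfc p⟩
    · exact ⟨m, hx, hm⟩

/-- Every algorithm yields a partition into parts that each correspond to `M` words of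
communication. -/
theorem Algorithm.mem_partCounts (hA : ∀ k, ∃ i, (i, k) ∈ SA) (hB : ∀ k, ∃ j, (k, j) ∈ SB)
    {M : ℕ} (hM : 0 < M) (alg : Algorithm SA SB M) :
    alg.cost / M + 1 ∈ partCounts SA SB (2 * M) := by
  obtain ⟨σ, ℓ, h0, h1, hseg⟩ := alg.run.exists_segments (alg.cost / M)
    (by rw [mul_comm]; exact (Nat.lt_mul_div_succ alg.cost hM).le)
  set k := alg.cost / M
  -- The least such `i` is the part of `m`. It exists and is at most `k`, because some output
  -- depends on `m` and is in memory at the end.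
  have hex (m : Mult SA SB) : ∃ i, ∃ y ∈ dependents alg.trees m,
      y ∈ (σ (i + 1)).fast ∪ (σ (i + 1)).slow := by
    obtain ⟨y, hy, hy'⟩ := exists_output_mem_dependents alg.trees m
    exact ⟨k, y, hy, h1 ▸ alg.complete hy'⟩
  classical
  have hle (m : Mult SA SB) : Nat.find (hex m) ≤ k := by
    obtain ⟨y, hy, hy'⟩ := exists_output_mem_dependents alg.trees m
    exact Nat.find_min' (hex m) ⟨y, hy, h1 ▸ alg.complete hy'⟩
  -- By minimality of the segment; for segment `0`, because memory initially holds inputs only.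
  have hbefore (m : Mult SA SB) : ∀ y ∈ dependents alg.trees m,
      y ∉ (σ (Nat.find (hex m))).fast ∪ (σ (Nat.find (hex m))).slow := by
    intro y hy hmem
    rcases Nat.eq_zero_or_eq_succ_pred (Nat.find (hex m)) with hz | hs
    · rw [hz, h0, alg.start_eq] at hmem
      exact notMem_inputs_of_mem_dependents hy hmem
    · rw [hs] at hmem
      exact Nat.find_min (hex m) (by omega : (Nat.find (hex m)).pred < _) ⟨y, hy, hmem⟩
  have hnum (i : Fin (k + 1)) : (i : ℕ) ≤ k := by omega
  have hload (i : Fin (k + 1)) : {v | Move.load v ∈ ℓ i}.encard ≤ M :=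
    (encard_setOf_load_mem_le _).trans (by exact_mod_cast (hseg i (hnum i)).2)
  have hstore (i : Fin (k + 1)) : {v | Move.store v ∈ ℓ i}.encard ≤ M :=
    (encard_setOf_store_mem_le _).trans (by exact_mod_cast (hseg i (hnum i)).2)
  have hinput (m : Mult SA SB) (x : GraphVertex alg.trees)
      (hx : x ∈ inputs (GraphEdge alg.trees)) (hxm : GraphEdge alg.trees x (GraphVertex.mul m)) :
      x ∈ (σ (Nat.find (hex m))).fast ∪ {v | Move.load v ∈ ℓ (Nat.find (hex m))} :=
    (hseg _ (hle m)).1.input_fast_or_load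
      (fun y hy hne => exists_pred_mem_dependents hy hne) hx hxm (hbefore m)
      (Nat.find_spec (hex m))
  refine exists_isNetPartition_of_mult hA hB
    (fun m => (⟨Nat.find (hex m), Nat.lt_succ_of_le (hle m)⟩ : Fin (k + 1))) ?_ ?_ ?_
  · intro i
    refine encard_le_two_mul GraphVertex.toA (hseg i (hnum i)).1.fast_start_le (hload i) ?_
    rintro _ ⟨m, rfl, rfl⟩
    exact ⟨_, hinput m _ (a_mem_inputs _ _) (GraphEdge.left m), rfl⟩
  · intro i
    refine encard_le_two_mul GraphVertex.toB (hseg i (hnum i)).1.fast_start_le (hload i) ?_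
    rintro _ ⟨m, rfl, rfl⟩
    exact ⟨_, hinput m _ (b_mem_inputs _ _) (GraphEdge.right m), rfl⟩
  · intro i
    refine encard_le_two_mul GraphVertex.toC (hseg i (hnum i)).1.fast_finish_le (hstore i) ?_
    rintro _ ⟨m, rfl, rfl⟩
    obtain ⟨y, hy, hy'⟩ := Nat.find_spec (hex m)
    obtain ⟨v, hv⟩ := exists_eq_sum_of_mem_dependents hy
    -- The dependent `y` survives to the end of the segment. If it is in slow memory, it was stored
    -- during the segment, as it was not in memory at the start.
    refine ⟨y, ?_, by rw [hv]; rfl⟩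
    rcases hy' with h | h
    · exact Or.inl h
    · rcases (hseg _ (hle m)).1.slow_or_store h with h' | h'
      · exact absurd (Or.inr h') (hbefore m y hy)
      · exact Or.inr h'

instance : Finite (Mult SA SB) :=
  Finite.of_injective (fun m => (m.i, m.k, m.j)) fun m m' h => by
    simp only [Prod.mk.injEq] at h
    exact Mult.ext h.1 h.2.1 h.2.2

/-- The partition into parts that each contain one multiplication is `1`-bounded. -/
theorem partCounts_nonempty (hA : ∀ k, ∃ i, (i, k) ∈ SA) (hB : ∀ k, ∃ j, (k, j) ∈ SB) {S : ℕ}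
    (hS : 1 ≤ S) : (partCounts SA SB S).Nonempty := by
  obtain ⟨n, ⟨e⟩⟩ := Finite.exists_equiv_fin (Mult SA SB)
  have hone {α : Type} (f : Mult SA SB → α) (i : Fin n) :
      {p | ∃ m, e m = i ∧ f m = p}.encard ≤ S := by
    refine le_trans (Set.encard_le_one_iff.2 ?_) (by exact_mod_cast hS)
    rintro _ _ ⟨m, hm, rfl⟩ ⟨m', hm', rfl⟩
    rw [e.injective (hm.trans hm'.symm)]
  exact ⟨n, exists_isNetPartition_of_mult hA hB e (hone _) (hone _) (hone _)⟩

end LowerBound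

/-! ### Runs with bounded communication: computing, deleting, loading and storing sets of vertices.
-/

section Reaches

variable {V : Type u} {E : V → V → Prop} {M : ℕ}

/-- `s'` can be reached from `s` with at most `c` words of communication. -/
def Reaches (E : V → V → Prop) (M : ℕ) (s : Memory V) (c : ℕ) (s' : Memory V) : Prop :=
  ∃ l, Run E M s l s' ∧ (l.map Move.words).sum ≤ c

theorem Reaches.refl {s : Memory V} (h : s.fast.encard ≤ M) : Reaches E M s 0 s :=
  ⟨[], Run.nil s h, by simp⟩

theorem Reaches.trans {s s' s'' : Memory V} {c c' : ℕ} (h : Reaches E M s c s')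
    (h' : Reaches E M s' c' s'') : Reaches E M s (c + c') s'' := by
  obtain ⟨l, hl, hc⟩ := h
  obtain ⟨l', hl', hc'⟩ := h'
  refine ⟨l ++ l', hl.append hl', ?_⟩
  rw [List.map_append, List.sum_append]
  omega

theorem Reaches.mono {s s' : Memory V} {c c' : ℕ} (h : Reaches E M s c s') (hc : c ≤ c') :
    Reaches E M s c' s' := by
  obtain ⟨l, hl, hl'⟩ := h
  exact ⟨l, hl, hl'.trans hc⟩

theorem Reaches.of_step {s s' : Memory V} {m : Move V} (hs : s.fast.encard ≤ M)
    (hs' : s'.fast.encard ≤ M) (h : Step E s m s') : Reaches E M s m.words s' :=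
  ⟨[m], Run.cons _ _ _ _ _ hs h (Run.nil _ hs'), by simp⟩

theorem reaches_compute {F W : Set V} {v : V} (hF : (insert v F).encard ≤ M)
    (hv : v ∉ inputs E) (h : ∀ w, E w v → w ∈ F) :
    Reaches E M ⟨F, W⟩ 0 ⟨insert v F, W⟩ :=
  Reaches.of_step (m := .compute v) ((Set.encard_le_encard (Set.subset_insert _ _)).trans hF) hF
    (Step.compute ⟨F, W⟩ v hv h)

theorem reaches_drop {F F' W : Set V} (hF : F.encard ≤ M) (h : F' ⊆ F) :
    Reaches E M ⟨F, W⟩ 0 ⟨F', W⟩ := by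
  have key (X : Set V) (hX : X.Finite) : Reaches E M ⟨F, W⟩ 0 ⟨F \ X, W⟩ := by
    induction X, hX using Set.Finite.induction_on with
    | empty => simpa using Reaches.refl (s := ⟨F, W⟩) hF
    | @insert a X _ _ ih =>
      have hle (Y : Set V) : (F \ Y).encard ≤ M :=
        (Set.encard_le_encard Set.sdiff_subset).trans hF
      have hs := Step.dropFast (E := E) ⟨F \ X, W⟩ a
      have he : (F \ X) \ {a} = F \ insert a X := by
        ext x; simp; tauto
      simp only [he] at hs
      exact ih.trans (Reaches.of_step (hle _) (hle _) hs)
  have hfin : F.Finite := Set.finite_of_encard_le_coe hF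
  have := key (F \ F') hfin.sdiff
  rwa [Set.sdiff_sdiff_cancel_left h] at this

theorem reaches_load {F W X : Set V} {k : ℕ} (hF : (F ∪ X).encard ≤ M) (hX : X ⊆ W)
    (hk : X.encard ≤ k) : Reaches E M ⟨F, W⟩ k ⟨F ∪ X, W⟩ := by
  have key (Y : Finset V) (hY : (Y : Set V) ⊆ X) :
      Reaches E M ⟨F, W⟩ Y.card ⟨F ∪ Y, W⟩ := by
    have hle (Z : Set V) (hZ : Z ⊆ X) : (F ∪ Z).encard ≤ M :=
      (Set.encard_le_encard (Set.union_subset_union_right _ hZ)).trans hF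
    classical
    induction Y using Finset.induction_on with
    | empty => simpa using Reaches.refl (s := ⟨F, W⟩) (by simpa using hle ∅ (by simp))
    | insert a Y ha ih =>
      have hYX : (Y : Set V) ⊆ X := by
        rw [Finset.coe_insert] at hY
        exact (Set.subset_insert _ _).trans hY
      have hs := Step.load (E := E) ⟨F ∪ Y, W⟩ a (hX (hY (by simp)))
      have he : insert a (F ∪ Y) = F ∪ ↑(insert a Y) := by
        rw [Finset.coe_insert, Set.union_insert]
      simp only [he] at hs
      rw [Finset.card_insert_of_notMem ha]
      exact (ih hYX).trans (Reaches.of_step (hle _ hYX) (hle _ hY) hs)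
  have hfin : X.Finite := Set.finite_of_encard_le_coe hk
  have := key hfin.toFinset (by simp)
  rw [hfin.coe_toFinset] at this
  refine this.mono ?_
  rw [hfin.encard_eq_coe_toFinset_card] at hk
  exact_mod_cast hk

theorem reaches_store {F W X : Set V} {k : ℕ} (hF : F.encard ≤ M) (hX : X ⊆ F)
    (hk : X.encard ≤ k) : Reaches E M ⟨F, W⟩ k ⟨F, W ∪ X⟩ := by
  have key (Y : Finset V) (hY : (Y : Set V) ⊆ X) :
      Reaches E M ⟨F, W⟩ Y.card ⟨F, W ∪ Y⟩ := by
    classical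
    induction Y using Finset.induction_on with
    | empty => simpa using Reaches.refl (s := ⟨F, W⟩) hF
    | insert a Y ha ih =>
      have hYX : (Y : Set V) ⊆ X := by
        rw [Finset.coe_insert] at hY
        exact (Set.subset_insert _ _).trans hY
      have hs := Step.store (E := E) ⟨F, W ∪ Y⟩ a (hX (hY (by simp)))
      have he : insert a (W ∪ Y) = W ∪ ↑(insert a Y) := by
        rw [Finset.coe_insert, Set.union_insert]
      simp only [he] at hs
      rw [Finset.card_insert_of_notMem ha]
      exact (ih hYX).trans (Reaches.of_step hF hF hs)
  have hfin : X.Finite := Set.finite_of_encard_le_coe hk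
  have := key hfin.toFinset (by simp)
  rw [hfin.coe_toFinset] at this
  refine this.mono ?_
  rw [hfin.encard_eq_coe_toFinset_card] at hk
  exact_mod_cast hk

end Reaches

/-! ### Summation trees that are chains of partial sums. -/

section Chain

variable {L : Type} (r : L → ℕ)

/-- The edges of the tree that adds its leaves one by one in the order of the ranks `r`; the
vertex `Sum.inr k` is the sum of the leaves up to `k`. -/
inductive ChainEdge : L ⊕ L → L ⊕ L → Prop
  | leaf (k : L) : ChainEdge (Sum.inl k) (Sum.inr k)
  | next (k k' : L) : r k < r k' → (∀ j, r j ≤ r k ∨ r k' ≤ r j) →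
      ChainEdge (Sum.inr k) (Sum.inr k')

variable {r}

/-- This height function rules out cycles; the shift by one keeps every partial sum above the
leaves. -/
theorem ChainEdge.lt {v w : L ⊕ L} (h : ChainEdge r v w) :
    Sum.elim (fun _ => 0) (fun k => r k + 1) v < Sum.elim (fun _ => 0) (fun k => r k + 1) w := by
  cases h with
  | leaf k => simp
  | next k k' h _ => simpa using h

theorem le_of_forall_not_chainEdge [Finite L] {k : L} (h : ∀ w, ¬ ChainEdge r (Sum.inr k) w)
    (j : L) : r j ≤ r k := by
  by_contra! hj
  obtain ⟨k', hk', hmin⟩ :=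
    Set.exists_min_image {j | r k < r j} r (Set.toFinite _) ⟨j, hj⟩
  exact h _ (ChainEdge.next k k' hk' fun i =>
    (le_or_gt (r i) (r k)).imp id fun hi => hmin i hi)

/-- The summation tree that adds its leaves one by one in the order of their ranks. -/
def chainTree [Finite L] [Nonempty L] (hr : Function.Injective r) : SummationTree L where
  Inner := L
  finite_inner := inferInstance
  edge := ChainEdge r
  acyclic v h := by
    have key {v w : L ⊕ L} (h : Relation.TransGen (ChainEdge r) v w) :
        Sum.elim (fun _ => 0) (fun k => r k + 1) v <
          Sum.elim (fun _ => 0) (fun k => r k + 1) w := by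
      induction h with
      | single h => exact h.lt
      | tail _ h ih => exact ih.trans h.lt
    exact lt_irrefl _ (key h)
  leaf_iff v := by
    constructor
    · intro h
      rcases v with l | k
      · exact ⟨l, rfl⟩
      · exact absurd (ChainEdge.leaf k) (h _)
    · rintro ⟨l, rfl⟩ w h
      cases h
  root := by
    obtain ⟨k, hk⟩ := Finite.exists_max r
    refine ⟨Sum.inr k, ?_, ?_⟩
    · intro w h
      cases h with
      | next _ k' h _ => exact absurd (hk k') (by omega)
    · intro v hv
      rcases v with l | k'
      · exact absurd (ChainEdge.leaf l) (hv _)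
      · rw [hr ((hk k').antisymm (le_of_forall_not_chainEdge hv k))]

end Chain

/-! ### Executing chains of partial sums block by block. -/

section ChainAlgorithm

variable {I K J : ℕ} {SA : Set (Fin I × Fin K)} {SB : Set (Fin K × Fin J)}

theorem Mult.ext_entries {m m' : Mult SA SB} (ha : m.aEntry = m'.aEntry)
    (hb : m.bEntry = m'.bEntry) : m = m' := by
  simp only [aEntry, bEntry, Subtype.mk.injEq, Prod.mk.injEq] at ha hb
  exact Mult.ext ha.1 ha.2 hb.2

theorem Mult.cEntry_eq_iff {m m' : Mult SA SB} :
    m.cEntry = m'.cEntry ↔ m.i = m'.i ∧ m.j = m'.j :=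
  Subtype.ext_iff.trans Prod.ext_iff

/-- The multiplication that gives a term of a sum. -/
def Term.toMult (p : Fin I × Fin J) (k : Term SA SB p) : Mult SA SB :=
  ⟨p.1, k.1, p.2, k.2.1, k.2.2⟩

theorem Term.toMult_injective (p : Fin I × Fin J) :
    Function.Injective (Term.toMult (SA := SA) (SB := SB) p) :=
  fun _ _ h => Subtype.ext (congrArg Mult.k h)

/-- The term that a multiplication gives. -/
def Mult.toTerm (m : Mult SA SB) : Term SA SB m.cEntry.1 :=
  ⟨m.k, m.left_mem, m.right_mem⟩

instance (p : prodNonzeros SA SB) : Nonempty (Term SA SB p.1) :=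
  ⟨⟨p.2.choose, p.2.choose_spec⟩⟩

variable {r : Mult SA SB → ℕ}

/-- The summation trees that add up the products in the order of the ranks `r`. -/
def chainTrees (hr : Function.Injective r) : Trees SA SB := fun p =>
  chainTree (r := fun k => r (Term.toMult p.1 k)) (hr.comp (Term.toMult_injective p.1))

/-- The sum of the products up to `m` that contribute to the same entry. -/
def partialSum (hr : Function.Injective r) (m : Mult SA SB) : GraphVertex (chainTrees hr) :=
  GraphVertex.sum m.cEntry (Sum.inr m.toTerm)

theorem exists_eq_partialSum (hr : Function.Injective r) (p : prodNonzeros SA SB)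
    (k : Term SA SB p.1) : ∃ m : Mult SA SB, m.cEntry = p ∧ m = Term.toMult p.1 k ∧
      (GraphVertex.sum p (Sum.inr k) : GraphVertex (chainTrees hr)) = partialSum hr m :=
  ⟨Term.toMult p.1 k, rfl, rfl, rfl⟩

/-- The multiplication or partial sum of a vertex. -/
def GraphVertex.toSumK {hr : Function.Injective r} :
    GraphVertex (chainTrees hr) → Option (Fin K ⊕ Fin K)
  | .sum _ (Sum.inl k) => some (Sum.inl k.1)
  | .sum p (Sum.inr k) => some (Sum.inr (show Term SA SB p.1 from k).1)
  | _ => none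

/-- The type of a tree vertex depends on its entry. Comparing `toC`, which yields the row and the
column, and `toSumK`, which yields the summation index, avoids equalities between dependent types.
-/
theorem mul_injective {hr : Function.Injective r} {m m' : Mult SA SB}
    (h : (GraphVertex.mul m : GraphVertex (chainTrees hr)) = GraphVertex.mul m') : m = m' := by
  have h1 := congrArg GraphVertex.toC h
  have h2 := congrArg GraphVertex.toSumK h
  simp only [GraphVertex.mul, GraphVertex.toC, GraphVertex.toSumK, Option.some.injEq,
    Sum.inl.injEq, Mult.cEntry_eq_iff] at h1 h2
  exact Mult.ext h1.1 h2 h1.2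

theorem partialSum_injective {hr : Function.Injective r} :
    Function.Injective (partialSum hr) := by
  intro m m' h
  have h1 := congrArg GraphVertex.toC h
  have h2 := congrArg GraphVertex.toSumK h
  simp only [partialSum, GraphVertex.toC, GraphVertex.toSumK, Option.some.injEq, Mult.toTerm,
    Sum.inr.injEq, Mult.cEntry_eq_iff] at h1 h2
  exact Mult.ext h1.1 h2 h1.2

theorem partialSum_notMem_inputs (hr : Function.Injective r) (m : Mult SA SB) :
    partialSum hr m ∉ inputs (GraphEdge (chainTrees hr)) :=
  fun h => h _ (GraphEdge.tree m.cEntry (Sum.inl m.toTerm) _ (ChainEdge.leaf m.toTerm))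

theorem eq_of_edge_mul {hr : Function.Injective r} {w : GraphVertex (chainTrees hr)}
    {m : Mult SA SB} (h : GraphEdge (chainTrees hr) w (GraphVertex.mul m)) :
    w = GraphVertex.a m.aEntry ∨ w = GraphVertex.b m.bEntry := by
  generalize hx : (GraphVertex.mul m : GraphVertex (chainTrees hr)) = x at h
  cases h with
  | left m' => exact Or.inl (by rw [mul_injective hx])
  | right m' => exact Or.inr (by rw [mul_injective hx])
  | tree p v w h =>
    have h2 := congrArg GraphVertex.toSumK hx
    cases h <;> simp [GraphVertex.mul, GraphVertex.toSumK] at h2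

theorem eq_of_edge_partialSum {hr : Function.Injective r} {w : GraphVertex (chainTrees hr)}
    {m : Mult SA SB} (h : GraphEdge (chainTrees hr) w (partialSum hr m)) :
    w = GraphVertex.mul m ∨ ∃ m', m'.cEntry = m.cEntry ∧ r m' < r m ∧
      (∀ m'', m''.cEntry = m.cEntry → r m'' ≤ r m' ∨ r m ≤ r m'') ∧ w = partialSum hr m' := by
  generalize hx : partialSum hr m = x at h
  cases h with
  | left m' =>
    have h2 := congrArg GraphVertex.toSumK hx
    simp [GraphVertex.mul, partialSum, GraphVertex.toSumK] at h2
  | right m' =>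
    have h2 := congrArg GraphVertex.toSumK hx
    simp [GraphVertex.mul, partialSum, GraphVertex.toSumK] at h2
  | tree p v w h =>
    cases h with
    | leaf k =>
      obtain ⟨m', -, hm', h'⟩ := exists_eq_partialSum hr p k
      obtain rfl := partialSum_injective (hx.trans h')
      subst hm'
      exact Or.inl rfl
    | next k k' hlt hnext =>
      obtain ⟨m', -, hm', h'⟩ := exists_eq_partialSum hr p k'
      obtain rfl := partialSum_injective (hx.trans h')
      subst hm'
      refine Or.inr ⟨Term.toMult p.1 k, rfl, hlt, ?_, rfl⟩
      rintro ⟨i, l, j, h₁, h₂⟩ hc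
      simp only [Mult.cEntry_eq_iff, Term.toMult] at hc
      obtain ⟨rfl, rfl⟩ := hc
      exact hnext ⟨l, h₁, h₂⟩

/-- The latest partial sums, for the entries in `C`, of the products of rank less than `t`. -/
def lastSums (hr : Function.Injective r) (t : ℕ) (C : Set (prodNonzeros SA SB)) :
    Set (GraphVertex (chainTrees hr)) :=
  {x | ∃ m, r m < t ∧ m.cEntry ∈ C ∧
    (∀ m', m'.cEntry = m.cEntry → r m' < t → r m' ≤ r m) ∧ x = partialSum hr m}

/-- Ranks are injective, so each entry has at most one latest sum. This is why a block needs only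
one word for each entry of the product. -/
theorem encard_lastSums_le (hr : Function.Injective r) (t : ℕ) (C : Set (prodNonzeros SA SB)) :
    (lastSums hr t C).encard ≤ C.encard := by
  rw [← (Option.some_injective _).injOn.encard_image (s := C)]
  refine Set.encard_le_encard_of_injOn (f := GraphVertex.toC) ?_ ?_
  · rintro _ ⟨m, -, hm, -, rfl⟩
    exact ⟨_, hm, rfl⟩
  · rintro _ ⟨m, h₁, -, h₂, rfl⟩ _ ⟨m', h₁', -, h₂', rfl⟩ h
    have h : m.cEntry = m'.cEntry := Option.some_injective _ h
    rw [hr ((h₂' m h h₁).antisymm (h₂ m' h.symm h₁'))]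

theorem lastSums_mono (hr : Function.Injective r) (t : ℕ) {C C' : Set (prodNonzeros SA SB)}
    (h : C ⊆ C') : lastSums hr t C ⊆ lastSums hr t C' := by
  rintro _ ⟨m, h₁, h₂, h₃, rfl⟩
  exact ⟨m, h₁, h h₂, h₃, rfl⟩

theorem mem_lastSums_succ {hr : Function.Injective r} {t : ℕ} {C : Set (prodNonzeros SA SB)}
    {x : GraphVertex (chainTrees hr)} (hx : x ∈ lastSums hr (t + 1) C) :
    x ∈ lastSums hr t C ∨ ∃ m, r m = t ∧ x = partialSum hr m := by
  obtain ⟨m, h₁, h₂, h₃, rfl⟩ := hx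
  rcases Nat.lt_succ_iff_lt_or_eq.1 h₁ with h | h
  · exact Or.inl ⟨m, h, h₂, fun m' hm' hlt => h₃ m' hm' (by omega), rfl⟩
  · exact Or.inr ⟨m, h, rfl⟩

/-- If the products of ranks from `t₀` to `t₁` contribute only to entries in `C`, then the partial
sums of the other entries stay the same. -/
theorem lastSums_univ_subset (hr : Function.Injective r) {t₀ t₁ : ℕ}
    {C : Set (prodNonzeros SA SB)} (ht : t₀ ≤ t₁)
    (hC : ∀ m, t₀ ≤ r m → r m < t₁ → m.cEntry ∈ C) :
    lastSums hr t₁ Set.univ ⊆ lastSums hr t₀ Set.univ ∪ lastSums hr t₁ C := by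
  rintro _ ⟨m, h₁, h₂, h₃, rfl⟩
  by_cases hm : m.cEntry ∈ C
  · exact Or.inr ⟨m, h₁, hm, h₃, rfl⟩
  · refine Or.inl ⟨m, ?_, h₂, fun m' hm' hlt => h₃ m' hm' (by omega), rfl⟩
    by_contra! h
    exact hm (hC m h h₁)

/-- The chain joins consecutive ranks of an entry, so the preceding partial sum is the latest one
before `m`. Holding the latest sums thus suffices for the next addition. -/
theorem mem_lastSums_of_edge {hr : Function.Injective r} {w : GraphVertex (chainTrees hr)}
    {m : Mult SA SB} {C : Set (prodNonzeros SA SB)} (hC : m.cEntry ∈ C)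
    (h : GraphEdge (chainTrees hr) w (partialSum hr m)) :
    w = GraphVertex.mul m ∨ w ∈ lastSums hr (r m) C := by
  refine (eq_of_edge_partialSum h).imp id ?_
  rintro ⟨m', hm', hlt, hnext, rfl⟩
  refine ⟨m', hlt, hm' ▸ hC, fun m'' hm'' hlt' => ?_, rfl⟩
  exact (hnext m'' (hm''.trans hm')).resolve_right (by omega)

/-- Every entry of a factor takes part in a multiplication and so is no output; what remains are the
ends of the chains. -/
theorem mem_lastSums_of_mem_outputs (hA : ∀ k, ∃ i, (i, k) ∈ SA) (hB : ∀ k, ∃ j, (k, j) ∈ SB)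
    {hr : Function.Injective r} {x : GraphVertex (chainTrees hr)}
    (hx : x ∈ outputs (GraphEdge (chainTrees hr))) {t : ℕ} (ht : ∀ m, r m < t) :
    x ∈ lastSums hr t Set.univ := by
  cases x with
  | a p =>
    obtain ⟨m, rfl⟩ := exists_aEntry_eq hB p
    exact absurd (GraphEdge.left m) (hx _)
  | b p =>
    obtain ⟨m, rfl⟩ := exists_bEntry_eq hA p
    exact absurd (GraphEdge.right m) (hx _)
  | sum p v =>
    have hv : ∀ w, ¬ ChainEdge (fun k => r (Term.toMult p.1 k)) v w :=
      fun w h => hx _ (GraphEdge.tree p v w h)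
    rcases v with k | k
    · exact absurd (ChainEdge.leaf k) (hv _)
    · refine ⟨Term.toMult p.1 k, ht _, trivial, ?_, rfl⟩
      rintro ⟨i, l, j, h₁, h₂⟩ hc -
      simp only [Mult.cEntry_eq_iff, Term.toMult] at hc
      obtain ⟨rfl, rfl⟩ := hc
      exact le_of_forall_not_chainEdge hv ⟨l, h₁, h₂⟩

/-- The content `W` of slow memory suffices to continue with the products of rank at least `t`. -/
def Resumable (hr : Function.Injective r) (t : ℕ) (W : Set (GraphVertex (chainTrees hr))) : Prop :=
  inputs (GraphEdge (chainTrees hr)) ⊆ W ∧ lastSums hr t Set.univ ⊆ W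

/-- One multiplication with `4` words of communication. -/
theorem Resumable.exists_succ {hr : Function.Injective r} {t M : ℕ} (hM : 3 ≤ M)
    {W : Set (GraphVertex (chainTrees hr))} (hW : Resumable hr t W) :
    ∃ W', Reaches (GraphEdge (chainTrees hr)) M ⟨∅, W⟩ 4 ⟨∅, W'⟩ ∧ Resumable hr (t + 1) W' := by
  by_cases hm : ∃ m, r m = t
  swap
  · refine ⟨W, (Reaches.refl (by simp)).mono (by omega), hW.1, fun x hx => ?_⟩
    rcases mem_lastSums_succ hx with h | ⟨m, h, -⟩
    exacts [hW.2 h, absurd ⟨m, h⟩ hm]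
  obtain ⟨m, rfl⟩ := hm
  have hM' : (3 : ℕ∞) ≤ M := by exact_mod_cast hM
  set L := lastSums hr (r m) {m.cEntry} with hL
  have hL1 : L.encard ≤ 1 := (encard_lastSums_le hr _ _).trans (Set.encard_singleton _).le
  have hpair (x y : GraphVertex (chainTrees hr)) : ({x, y} : Set _).encard ≤ 2 :=
    (Set.encard_insert_le _ _).trans (by rw [Set.encard_singleton]; norm_num)
  have s1 : Reaches (GraphEdge (chainTrees hr)) M ⟨∅, W⟩ 2
      ⟨{.a m.aEntry, .b m.bEntry}, W⟩ := by
    have := reaches_load (E := GraphEdge (chainTrees hr)) (M := M) (F := ∅) (W := W) (k := 2)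
      (X := {.a m.aEntry, .b m.bEntry})
      (by rw [Set.empty_union]; exact (hpair _ _).trans (le_trans (by norm_num) hM'))
      (by
        rintro x (rfl | rfl)
        exacts [hW.1 (a_mem_inputs _ _), hW.1 (b_mem_inputs _ _)])
      (hpair _ _)
    rwa [Set.empty_union] at this
  have h2 : (insert (GraphVertex.mul m) {.a m.aEntry, .b m.bEntry} :
      Set (GraphVertex (chainTrees hr))).encard ≤ M :=
    ((Set.encard_insert_le _ _).trans (add_le_add_left (hpair _ _) 1)).trans
      (le_trans (by norm_num) hM')
  have s2 := reaches_compute (E := GraphEdge (chainTrees hr)) (W := W) h2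
    (mul_notMem_inputs _ m) (fun w hw => eq_of_edge_mul hw)
  -- Both factors are deleted before the previous sum is loaded. Fast memory holds two factors and a
  -- product, then a product and two sums, so three words suffice.
  have s3 := reaches_drop (E := GraphEdge (chainTrees hr)) (W := W) h2
    (F' := {GraphVertex.mul m}) (by simp)
  have h4 : ({GraphVertex.mul m} ∪ L).encard ≤ 2 :=
    (Set.encard_union_le _ _).trans (by
      rw [Set.encard_singleton]
      exact (add_le_add_right hL1 1).trans (by norm_num))
  have s4 := reaches_load (E := GraphEdge (chainTrees hr)) (W := W) (k := 1)
    (h4.trans (le_trans (by norm_num) hM')) ((lastSums_mono hr _ (Set.subset_univ _)).trans hW.2)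
    (by exact_mod_cast hL1)
  have h5 : (insert (partialSum hr m) ({GraphVertex.mul m} ∪ L)).encard ≤ M :=
    ((Set.encard_insert_le _ _).trans (add_le_add_left h4 1)).trans (le_trans (by norm_num) hM')
  have s5 := reaches_compute (E := GraphEdge (chainTrees hr)) (W := W) h5
    (partialSum_notMem_inputs hr m) (fun w hw => mem_lastSums_of_edge rfl hw)
  have s6 := reaches_store (E := GraphEdge (chainTrees hr)) (W := W) (k := 1) h5
    (X := {partialSum hr m}) (by simp) (by simp)
  have s7 := reaches_drop (E := GraphEdge (chainTrees hr)) (W := W ∪ {partialSum hr m}) h5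
    (Set.empty_subset _)
  refine ⟨_, ((((((s1.trans s2).trans s3).trans s4).trans s5).trans s6).trans s7).mono
    (by norm_num), hW.1.trans Set.subset_union_left, fun x hx => ?_⟩
  rcases mem_lastSums_succ hx with h | ⟨m', h, rfl⟩
  · exact Or.inl (hW.2 h)
  · rw [hr h]
    exact Or.inr rfl

/-- The products of ranks from `t₀` to `t₁`, if they involve at most `b` entries of each matrix,
with `4 * b` words of communication. -/
theorem Resumable.exists_block {hr : Function.Injective r} {t₀ t₁ M b : ℕ} (hM : 3 * b + 2 ≤ M)
    (ht : t₀ ≤ t₁) {A : Set SA} {B : Set SB} {C : Set (prodNonzeros SA SB)}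
    (hA : A.encard ≤ b) (hB : B.encard ≤ b) (hC : C.encard ≤ b)
    (h : ∀ m, t₀ ≤ r m → r m < t₁ → m.aEntry ∈ A ∧ m.bEntry ∈ B ∧ m.cEntry ∈ C)
    {W : Set (GraphVertex (chainTrees hr))} (hW : Resumable hr t₀ W) :
    ∃ W', Reaches (GraphEdge (chainTrees hr)) M ⟨∅, W⟩ (4 * b) ⟨∅, W'⟩ ∧
      Resumable hr t₁ W' := by
  -- The content of fast memory before the product of rank `t`. Each step needs two more words, for
  -- the product and the new sum, which accounts for `3 * b + 2`.
  let F (t : ℕ) : Set (GraphVertex (chainTrees hr)) :=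
    (GraphVertex.a '' A ∪ GraphVertex.b '' B) ∪ lastSums hr t C
  have hF (t : ℕ) : (F t).encard ≤ (3 * b : ℕ) := by
    calc (F t).encard ≤ (b + b : ℕ∞) + b :=
          (Set.encard_union_le _ _).trans (add_le_add ((Set.encard_union_le _ _).trans
            (add_le_add ((Set.encard_image_le _ _).trans hA)
              ((Set.encard_image_le _ _).trans hB))) ((encard_lastSums_le hr t C).trans hC))
      _ = (3 * b : ℕ) := by push_cast; ring
  have hFM (t : ℕ) : (F t).encard ≤ M := (hF t).trans (by exact_mod_cast (by omega))
  have hstep (t : ℕ) (h0 : t₀ ≤ t) (h1 : t < t₁) :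
      Reaches (GraphEdge (chainTrees hr)) M ⟨F t, W⟩ 0 ⟨F (t + 1), W⟩ := by
    by_cases hm : ∃ m, r m = t
    swap
    · refine reaches_drop (hFM t) (Set.union_subset_union_right _ fun x hx => ?_)
      rcases mem_lastSums_succ hx with h | ⟨m, h, -⟩
      exacts [h, absurd ⟨m, h⟩ hm]
    obtain ⟨m, rfl⟩ := hm
    obtain ⟨hmA, hmB, hmC⟩ := h m h0 h1
    have h2 : (insert (partialSum hr m) (insert (GraphVertex.mul m) (F (r m)))).encard ≤ M := by
      refine (Set.encard_insert_le _ _).trans ((add_le_add_left ((Set.encard_insert_le _ _).trans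
        (add_le_add_left (hF (r m)) 1)) 1).trans ?_)
      exact_mod_cast hM
    refine ((reaches_compute (v := GraphVertex.mul m) ?_ (mul_notMem_inputs _ m) ?_).trans
      (reaches_compute (v := partialSum hr m) h2 (partialSum_notMem_inputs hr m) ?_)).trans
      (reaches_drop h2 ?_)
    · exact (Set.encard_le_encard (Set.subset_insert _ _)).trans h2
    · intro w hw
      rcases eq_of_edge_mul hw with rfl | rfl
      · exact Or.inl (Or.inl ⟨_, hmA, rfl⟩)
      · exact Or.inl (Or.inr ⟨_, hmB, rfl⟩)
    · intro w hw
      exact (mem_lastSums_of_edge hmC hw).imp id Or.inr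
    · rintro x (hx | hx)
      · exact Or.inr (Or.inr (Or.inl hx))
      · rcases mem_lastSums_succ hx with h | ⟨m', h, rfl⟩
        · exact Or.inr (Or.inr (Or.inr h))
        · exact Or.inl (by rw [hr h])
  have hrun (t : ℕ) (h0 : t₀ ≤ t) :
      t ≤ t₁ → Reaches (GraphEdge (chainTrees hr)) M ⟨F t₀, W⟩ 0 ⟨F t, W⟩ := by
    induction t, h0 using Nat.le_induction with
    | base => exact fun _ => Reaches.refl (hFM t₀)
    | succ t h0 ih => exact fun h1 => (ih (by omega)).trans (hstep t h0 h1)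
  have hload : Reaches (GraphEdge (chainTrees hr)) M ⟨∅, W⟩ (3 * b) ⟨F t₀, W⟩ := by
    have := reaches_load (E := GraphEdge (chainTrees hr)) (M := M) (F := ∅) (W := W) (X := F t₀)
      (by rw [Set.empty_union]; exact hFM t₀)
      (by
        rintro x ((⟨p, -, rfl⟩ | ⟨p, -, rfl⟩) | hx)
        exacts [hW.1 (a_mem_inputs _ _), hW.1 (b_mem_inputs _ _),
          hW.2 (lastSums_mono hr _ (Set.subset_univ _) hx)])
      (hF t₀)
    rwa [Set.empty_union] at this
  have hstore := reaches_store (E := GraphEdge (chainTrees hr)) (W := W) (X := lastSums hr t₁ C)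
    (hFM t₁) Set.subset_union_right ((encard_lastSums_le hr t₁ C).trans hC)
  refine ⟨_, (((hload.trans (hrun t₁ ht le_rfl)).trans hstore).trans
    (reaches_drop (hFM t₁) (Set.empty_subset _))).mono (by omega),
    hW.1.trans Set.subset_union_left, ?_⟩
  exact (lastSums_univ_subset hr ht fun m h0 h1 => (h m h0 h1).2.2).trans
    (Set.union_subset_union_left _ hW.2)

/-- An algorithm that proceeds in `N` phases of at most `c` words of communication. -/
theorem exists_algorithm_of_phases (hA : ∀ k, ∃ i, (i, k) ∈ SA) (hB : ∀ k, ∃ j, (k, j) ∈ SB)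
    (hr : Function.Injective r) {M N c : ℕ} (τ : ℕ → ℕ) (h0 : τ 0 = 0) (hN : ∀ m, r m < τ N)
    (h : ∀ j < N, ∀ W, Resumable hr (τ j) W →
      ∃ W', Reaches (GraphEdge (chainTrees hr)) M ⟨∅, W⟩ c ⟨∅, W'⟩ ∧ Resumable hr (τ (j + 1)) W') :
    ∃ alg : Algorithm SA SB M, alg.FromSlowToSlow ∧ alg.cost ≤ N * c := by
  have key (j : ℕ) : j ≤ N → ∃ W', Reaches (GraphEdge (chainTrees hr)) M
      ⟨∅, inputs (GraphEdge (chainTrees hr))⟩ (j * c) ⟨∅, W'⟩ ∧ Resumable hr (τ j) W' := by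
    induction j with
    | zero =>
      refine fun _ => ⟨_, (Reaches.refl (by simp)).mono (by omega), subset_rfl, ?_⟩
      rintro _ ⟨m, hm, -⟩
      omega
    | succ j ih =>
      intro hj
      obtain ⟨W, h1, h2⟩ := ih (by omega)
      obtain ⟨W', h3, h4⟩ := h j hj W h2
      exact ⟨W', (h1.trans h3).mono (by rw [Nat.succ_mul]), h4⟩
  obtain ⟨W, ⟨l, hl, hc⟩, hW⟩ := key N le_rfl
  exact ⟨⟨chainTrees hr, _, _, l, by simp, hl, fun x hx => Or.inr
    (hW.2 (mem_lastSums_of_mem_outputs hA hB hx hN))⟩, ⟨rfl, rfl⟩, hc⟩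

end ChainAlgorithm

/-- A set of at most `S` elements splits into `S / b + 1` groups of at most `b` elements. -/
theorem exists_grouping {α : Type*} {s : Set α} {S b : ℕ} (hs : s.encard ≤ S) (hb : 0 < b) :
    ∃ g : α → Fin (S / b + 1), ∀ i, {x ∈ s | g x = i}.encard ≤ b := by
  have hcard (m n : ℕ) : (Set.Ico m (m + n)).encard = n := by
    rw [← Finset.coe_Ico, Set.encard_coe_eq_coe_finsetCard, Nat.card_Ico, Nat.add_sub_cancel_left]
  obtain ⟨f, hf, hinj⟩ := (Set.finite_of_encard_le_coe hs).exists_injOn_of_encard_le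
    (t := Set.Ico 0 (0 + S)) (by rwa [hcard])
  -- The elements of `s` are numbered below `S` and cut into runs of length `b`. The reduction in
  -- `Fin.ofNat` has no effect on them, as `f x / b ≤ S / b`.
  refine ⟨fun x => Fin.ofNat _ (f x / b), fun i => ?_⟩
  rw [← hcard (i * b) b]
  refine Set.encard_le_encard_of_injOn (f := f) ?_ (hinj.mono fun x hx => hx.1)
  rintro x ⟨hx, rfl⟩
  have hfx : f x < S := by simpa using (hf hx).2
  have hlt : f x / b < S / b + 1 := Nat.lt_succ_of_le (Nat.div_le_div_right hfx.le)
  simp only [Fin.val_ofNat, Nat.mod_eq_of_lt hlt, Set.mem_Ico]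
  exact ⟨Nat.div_mul_le_self _ _, Nat.lt_div_mul_add hb⟩

/-! ### From a partition to an algorithm. -/

section UpperBound

variable {I K J : ℕ} {SA : Set (Fin I × Fin K)} {SB : Set (Fin K × Fin J)}

/-- A multiplication is determined by its two factors, and each part offers at most `S` choices for
either one. -/
theorem IsNetPartition.card_mult_le {S n : ℕ} {P : Fin n → Set (Vertex SA SB)}
    (hP : IsNetPartition S P) : Nat.card (Mult SA SB) ≤ n * (S * S) := by
  have hcov (m : Mult SA SB) : ∃ t, Vertex.mul m ∈ P t := by
    simpa using hP.cover.ge (Set.mem_univ (Vertex.mul m))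
  choose t ht using hcov
  have hgroup {α : Type} {s : Set α} (hs : s.encard ≤ S) :
      ∃ f : α → ℕ, Set.MapsTo f s (Set.Iio S) ∧ Set.InjOn f s := by
    obtain ⟨f, hf, hinj⟩ := (Set.finite_of_encard_le_coe hs).exists_injOn_of_encard_le
      (t := Set.Iio S) (by
        rwa [← Finset.coe_Iio, Set.encard_coe_eq_coe_finsetCard, Nat.card_Iio])
    exact ⟨f, hf, hinj⟩
  choose fa hfa hfa' using fun t => hgroup (hP.meets t).1
  choose fb hfb hfb' using fun t => hgroup (hP.meets t).2.1
  have ha (m : Mult SA SB) : (aNet m.aEntry ∩ P (t m)).Nonempty := ⟨_, Or.inr ⟨m, rfl, rfl⟩, ht m⟩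
  have hb (m : Mult SA SB) : (bNet m.bEntry ∩ P (t m)).Nonempty := ⟨_, Or.inr ⟨m, rfl, rfl⟩, ht m⟩
  have hinj : Function.Injective fun m : Mult SA SB => (t m, (⟨fa (t m) m.aEntry, hfa _ (ha m)⟩ :
      Fin S), (⟨fb (t m) m.bEntry, hfb _ (hb m)⟩ : Fin S)) := by
    intro m m' h
    obtain ⟨h1, h23⟩ := Prod.mk.inj h
    have h2 : fa (t m) m.aEntry = fa (t m') m'.aEntry := Fin.mk.inj (Prod.mk.inj h23).1
    have h3 : fb (t m) m.bEntry = fb (t m') m'.bEntry := Fin.mk.inj (Prod.mk.inj h23).2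
    rw [h1] at h2 h3
    exact Mult.ext_entries (hfa' _ (h1 ▸ ha m) (ha m') h2) (hfb' _ (h1 ▸ hb m) (hb m') h3)
  simpa using Nat.card_le_card_of_injective _ hinj

/-- An algorithm with one phase for each multiplication. -/
theorem exists_algorithm_of_card (hA : ∀ k, ∃ i, (i, k) ∈ SA) (hB : ∀ k, ∃ j, (k, j) ∈ SB)
    {M : ℕ} (hM : 3 ≤ M) :
    ∃ alg : Algorithm SA SB M, alg.FromSlowToSlow ∧ alg.cost ≤ Nat.card (Mult SA SB) * 4 := by
  let e := Finite.equivFin (Mult SA SB)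
  have hr : Function.Injective fun m => (e m : ℕ) := Fin.val_injective.comp e.injective
  exact exists_algorithm_of_phases hA hB hr id rfl (fun m => (e m).2)
    fun j _ W hW => hW.exists_succ hM

/-- An algorithm that processes the multiplications in blocks which involve at most `b` entries of
each matrix. -/
theorem exists_algorithm_of_blocks (hA : ∀ k, ∃ i, (i, k) ∈ SA) (hB : ∀ k, ∃ j, (k, j) ∈ SB)
    {M N b : ℕ} (hM : 3 * b + 2 ≤ M) (β : Mult SA SB → Fin N)
    (ha : ∀ i, {p : SA | ∃ m, β m = i ∧ m.aEntry = p}.encard ≤ b)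
    (hb : ∀ i, {p : SB | ∃ m, β m = i ∧ m.bEntry = p}.encard ≤ b)
    (hc : ∀ i, {p : prodNonzeros SA SB | ∃ m, β m = i ∧ m.cEntry = p}.encard ≤ b) :
    ∃ alg : Algorithm SA SB M, alg.FromSlowToSlow ∧ alg.cost ≤ N * (4 * b) := by
  let e := Finite.equivFin (Mult SA SB)
  set c := Nat.card (Mult SA SB)
  have hdiv (m : Mult SA SB) : (β m * c + e m) / c = β m := by
    rw [mul_comm, Nat.mul_add_div (Fin.pos (e m)), Nat.div_eq_of_lt (e m).2, add_zero]
  -- The rank orders by block first, so block `j` occupies the ranks from `j * c` up to `(j + 1) *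
  -- c`.
  have hr : Function.Injective fun m => (β m * c + e m : ℕ) := by
    intro m m' h
    have h1 : (β m : ℕ) = β m' := by rw [← hdiv m, ← hdiv m']; exact congrArg (· / c) h
    simp only [h1, add_right_inj] at h
    exact e.injective (Fin.ext h)
  refine exists_algorithm_of_phases hA hB hr (fun j => j * c) (by simp) (fun m => ?_)
    fun j hj W hW => hW.exists_block hM (Nat.mul_le_mul_right c j.le_succ)
      (ha ⟨j, hj⟩) (hb ⟨j, hj⟩) (hc ⟨j, hj⟩) fun m h0 h1 => ?_
  · calc (β m * c + e m : ℕ) < β m * c + c := Nat.add_lt_add_left (e m).2 _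
      _ = (β m + 1) * c := (Nat.succ_mul _ _).symm
      _ ≤ N * c := Nat.mul_le_mul_right c (β m).2
  · have hj' : β m = ⟨j, hj⟩ := by
      refine Fin.ext ?_
      rw [← hdiv m]
      exact Nat.div_eq_of_lt_le h0 h1
    exact ⟨⟨m, hj', rfl⟩, ⟨m, hj', rfl⟩, ⟨m, hj', rfl⟩⟩

/-- A block consists of the multiplications in one part whose three entries lie in prescribed
groups, hence the cube. -/
theorem IsNetPartition.exists_algorithm_of_blockSize (hA : ∀ k, ∃ i, (i, k) ∈ SA)
    (hB : ∀ k, ∃ j, (k, j) ∈ SB) {S n : ℕ} {P : Fin n → Set (Vertex SA SB)}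
    (hP : IsNetPartition S P) {M b : ℕ} (hM : 3 * b + 2 ≤ M) (hb : 0 < b) :
    ∃ alg : Algorithm SA SB M, alg.FromSlowToSlow ∧
      alg.cost ≤ n * (S / b + 1) ^ 3 * (4 * b) := by
  have hcov (m : Mult SA SB) : ∃ t, Vertex.mul m ∈ P t := by
    simpa using hP.cover.ge (Set.mem_univ (Vertex.mul m))
  choose t ht using hcov
  choose ga hga using fun t => exists_grouping (hP.meets t).1 hb
  choose gb hgb using fun t => exists_grouping (hP.meets t).2.1 hb
  choose gc hgc using fun t => exists_grouping (hP.meets t).2.2 hb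
  let q := S / b + 1
  let ε := Finite.equivFinOfCardEq (α := Fin n × Fin q × Fin q × Fin q) (n := n * q ^ 3)
    (by simp only [Nat.card_prod, Nat.card_fin]; ring)
  refine exists_algorithm_of_blocks hA hB hM (fun m => ε (t m, ga (t m) m.aEntry,
    gb (t m) m.bEntry, gc (t m) m.cEntry)) (fun i => ?_) (fun i => ?_) (fun i => ?_)
  · refine (Set.encard_le_encard ?_).trans (hga (ε.symm i).1 (ε.symm i).2.1)
    rintro _ ⟨m, rfl, rfl⟩
    exact ⟨⟨_, Or.inr ⟨m, rfl, rfl⟩, by simpa using ht m⟩, by simp⟩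
  · refine (Set.encard_le_encard ?_).trans (hgb (ε.symm i).1 (ε.symm i).2.2.1)
    rintro _ ⟨m, rfl, rfl⟩
    exact ⟨⟨_, Or.inr ⟨m, rfl, rfl⟩, by simpa using ht m⟩, by simp⟩
  · refine (Set.encard_le_encard ?_).trans (hgc (ε.symm i).1 (ε.symm i).2.2.2)
    rintro _ ⟨m, rfl, rfl⟩
    exact ⟨⟨_, Or.inr ⟨m, rfl, rfl⟩, by simpa using ht m⟩, by simp⟩

theorem IsNetPartition.exists_algorithm (hA : ∀ k, ∃ i, (i, k) ∈ SA)
    (hB : ∀ k, ∃ j, (k, j) ∈ SB) {S n : ℕ} {P : Fin n → Set (Vertex SA SB)}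
    (hP : IsNetPartition S P) {M : ℕ} (hM : 3 ≤ M) :
    ∃ alg : Algorithm SA SB M, alg.FromSlowToSlow ∧
      (alg.cost : ℝ) ≤ 1372 * ((M : ℝ) * (n : ℝ) * ((S : ℝ) / (M : ℝ) + 1) ^ 3) := by
  have hM0 : (0 : ℝ) < M := by exact_mod_cast (by omega : 0 < M)
  have hx : (0 : ℝ) ≤ (S : ℝ) / M := by positivity
  -- A block with `b = 1` needs five words. For `M = 3` and `M = 4` the multiplications are done one
  -- at a time, at a cost of at most `4 * n * S ^ 2`.
  rcases lt_or_ge M 5 with h5 | h5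
  · obtain ⟨alg, h1, h2⟩ := exists_algorithm_of_card hA hB hM
    refine ⟨alg, h1, ?_⟩
    have h3 : (alg.cost : ℝ) ≤ n * (S * S) * 4 := by
      exact_mod_cast h2.trans (Nat.mul_le_mul_right 4 hP.card_mult_le)
    have hM5 : (M : ℝ) ≤ 5 := by exact_mod_cast h5.le
    set x := (S : ℝ) / M
    have hS : (S : ℝ) = M * x := by simp only [x]; field_simp
    have h4 : x ^ 2 ≤ (x + 1) ^ 3 := by nlinarith [mul_nonneg hx hx, mul_nonneg hx (mul_nonneg hx hx)]
    calc (alg.cost : ℝ) ≤ 4 * M * (M * n * x ^ 2) := by rw [hS] at h3; linarith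
      _ ≤ 1372 * (M * n * (x + 1) ^ 3) := by
        gcongr
        linarith
  -- The largest block size that fits. The ratio `M / b` is greatest at `M = 7`, where `b = 1`; the
  -- final constant is `1372 = 4 * 7 ^ 3`.
  · obtain ⟨b, hb, hb1, hb7⟩ : ∃ b, 3 * b + 2 ≤ M ∧ 0 < b ∧ M ≤ 7 * b :=
      ⟨(M - 2) / 3, by omega, by omega, by omega⟩
    obtain ⟨alg, h1, h2⟩ := hP.exists_algorithm_of_blockSize hA hB hb hb1
    refine ⟨alg, h1, ?_⟩
    have h3 : (alg.cost : ℝ) ≤ n * ((S / b : ℕ) + 1) ^ 3 * (4 * b) := by exact_mod_cast h2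
    have hb0 : (0 : ℝ) < b := by exact_mod_cast hb1
    have hbM : (b : ℝ) ≤ M := by exact_mod_cast (by omega : b ≤ M)
    have hMb : (M : ℝ) ≤ 7 * b := by exact_mod_cast hb7
    have h4 : ((S / b : ℕ) : ℝ) + 1 ≤ 7 * ((S : ℝ) / M + 1) := by
      have h6 : (S : ℝ) / b ≤ 7 * ((S : ℝ) / M) := by
        rw [← mul_div_assoc, div_le_div_iff₀ hb0 hM0]
        nlinarith [(Nat.cast_nonneg S : (0 : ℝ) ≤ S)]
      have := (Nat.cast_div_le (m := S) (n := b) : ((S / b : ℕ) : ℝ) ≤ S / b)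
      linarith
    calc (alg.cost : ℝ) ≤ n * (7 * ((S : ℝ) / M + 1)) ^ 3 * (4 * M) := by
          refine h3.trans ?_
          gcongr
      _ = 1372 * (M * n * ((S : ℝ) / M + 1) ^ 3) := by ring

end UpperBound

end SpGEMM

theorem mainTheorem2 :
    ∃ κ : ℝ, 0 < κ ∧
      ∀ (X : Type u) [Zero X] (I K J M : ℕ)
        (A : Matrix (Fin I) (Fin K) X) (B : Matrix (Fin K) (Fin J) X),
        SpGEMM.NoZeroRowOrColumn A → SpGEMM.NoZeroRowOrColumn B → 3 ≤ M →
        (∃ h : ℕ,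
          IsLeast (SpGEMM.partCounts (SpGEMM.nonzeros A) (SpGEMM.nonzeros B) (2 * M)) h ∧
          (∀ alg : SpGEMM.Algorithm (SpGEMM.nonzeros A) (SpGEMM.nonzeros B) M,
            (M : ℝ) * ((h : ℝ) - 1) ≤ (alg.cost : ℝ)) ∧
          (1 < h →
            ∃ alg : SpGEMM.Algorithm (SpGEMM.nonzeros A) (SpGEMM.nonzeros B) M,
              alg.FromSlowToSlow ∧ (alg.cost : ℝ) ≤ κ * ((M : ℝ) * ((h : ℝ) - 1)))) ∧
        (∀ (S n : ℕ)
          (P : Fin n → Set (SpGEMM.Vertex (SpGEMM.nonzeros A) (SpGEMM.nonzeros B))),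
          1 ≤ S → SpGEMM.IsNetPartition S P →
          ∃ alg : SpGEMM.Algorithm (SpGEMM.nonzeros A) (SpGEMM.nonzeros B) M,
            alg.FromSlowToSlow ∧
              (alg.cost : ℝ) ≤ κ * ((M : ℝ) * (n : ℝ) * ((S : ℝ) / (M : ℝ) + 1) ^ 3)) := by
  -- For the second claim, `S = 2 * M` contributes `3 ^ 3 = 27`, and `h ≤ 2 * (h - 1)` for `h ≥ 2`
  -- doubles it to `54`.
  refine ⟨54 * 1372, by norm_num, fun X _ I K J M A B hA hB hM => ?_⟩
  have hA' : ∀ k, ∃ i, (i, k) ∈ SpGEMM.nonzeros A := hA.2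
  have hB' : ∀ k, ∃ j, (k, j) ∈ SpGEMM.nonzeros B := hB.1
  have hM0 : (0 : ℝ) < M := by exact_mod_cast (by omega : 0 < M)
  obtain ⟨h, hh⟩ : ∃ h, IsLeast
      (SpGEMM.partCounts (SpGEMM.nonzeros A) (SpGEMM.nonzeros B) (2 * M)) h :=
    have hne := SpGEMM.partCounts_nonempty hA' hB' (by omega : 1 ≤ 2 * M)
    ⟨_, Nat.sInf_mem hne, fun _ h => Nat.sInf_le h⟩
  refine ⟨⟨h, hh, fun alg => ?_, fun h1 => ?_⟩, fun S n P _ hP => ?_⟩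
  · have h2 : (h : ℝ) ≤ (alg.cost / M : ℕ) + 1 := by
      exact_mod_cast hh.2 (alg.mem_partCounts hA' hB' (by omega))
    have h3 : (M : ℝ) * (alg.cost / M : ℕ) ≤ alg.cost := by
      exact_mod_cast Nat.mul_div_le alg.cost M
    nlinarith
  · obtain ⟨P, hP⟩ := hh.1
    obtain ⟨alg, h2, h3⟩ := hP.exists_algorithm hA' hB' hM
    refine ⟨alg, h2, h3.trans ?_⟩
    have h4 : (2 : ℝ) ≤ h := by exact_mod_cast h1
    have h5 : ((2 * M : ℕ) : ℝ) / M + 1 = 3 := by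
      push_cast
      field_simp
      norm_num
    rw [h5]
    nlinarith
  · obtain ⟨alg, h2, h3⟩ := hP.exists_algorithm hA' hB' hM
    refine ⟨alg, h2, h3.trans ?_⟩
    gcongr
    norm_num
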